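/- Let $K\ge 1$ and let $N_0,N_1,\dots,N_K$ be positive integers with $N_0=\min_{0\le k\le K}N_k$. Let $Q_1,\dots,Q_K$ be independent random complex matrices, $Q_k$ of size $N_k\times N_{k-1}$, each having independent and identically distributed standard complex Gaussian entries $\mathcal{CN}(0,1)$ (that is, with density $\pi^{-1}e^{-|z|^2}$ on $\mathbb{C}$), and let $H=Q_KQ_{K-1}\cdots Q_1$, a random $N_K\times N_0$ matrix (the Rayleigh product channel). Let $\hat Q_1,\dots,\hat Q_K$ be independent random complex matrices, $\hat Q_k$ of size $N_k\times N_0$, each having independent and identically distributed $\mathcal{CN}(0,1)$ entries. Then the determinants $\det(H^\dagger H)$ and $\det(\hat Q_k^\dagger\hat Q_k)$, $1\le k\le K$, are almost surely positive, their logarithms are integrable, and $$\mathbb{E}\big[\ln\det(H^\dagger H)\big]=\sum_{k=1}^{K}\mathbb{E}\big[\ln\det(\hat Q_k^\dagger\hat Q_k)\big],$$ where $A^\dagger$ denotes the conjugate transpose of $A$. -/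

import Mathlib

open MeasureTheory ProbabilityTheory
open scoped Matrix

/-- Matrices carry the product (entrywise) σ-algebra. -/
instance matrixMeasurableSpace {m n α : Type*} [MeasurableSpace α] :
    MeasurableSpace (Matrix m n α) :=
  (MeasurableSpace.pi : MeasurableSpace (m → n → α))

/-- The standard circularly symmetric complex Gaussian law `CN(0, 1)` (zero mean, `E|z|² = 1`):
real and imaginary part are independent real Gaussians with mean `0` and variance `1/2`.
Its density with respect to Lebesgue measure on `ℂ` is `exp (-|z|²) / π`. -/
noncomputable def stdComplexGaussian : Measure ℂ :=
  ((gaussianReal 0 (1 / 2)).prod (gaussianReal 0 (1 / 2))).map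
    Complex.measurableEquivRealProd.symm

/-- `Q` is a random `m × n` Rayleigh MIMO channel on `(Ω, μ)`: a random matrix whose entries are
independent and identically distributed `CN(0, 1)` random variables. -/
def IsRayleighMIMO {Ω : Type*} [MeasurableSpace Ω] {m n : ℕ}
    (Q : Ω → Matrix (Fin m) (Fin n) ℂ) (μ : Measure Ω) : Prop :=
  (∀ i j, HasLaw (fun ω => Q ω i j) stdComplexGaussian μ) ∧
    iIndepFun (fun (p : Fin m × Fin n) ω => Q ω p.1 p.2) μ

/-- The ordered matrix product `Q_K * ⋯ * Q_2 * Q_1`, where `Q_{k+1}` (the matrix `Q k`, for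
`k = 0, …, K - 1`) has size `N (k + 1) × N k`. -/
def channelProduct {K : ℕ} (N : Fin (K + 1) → ℕ)
    (Q : ∀ k : Fin K, Matrix (Fin (N k.succ)) (Fin (N k.castSucc)) ℂ) :
    Matrix (Fin (N (Fin.last K))) (Fin (N 0)) ℂ :=
  Fin.induction (motive := fun i => Matrix (Fin (N i)) (Fin (N 0)) ℂ)
    1 (fun k P => Q k * P) (Fin.last K)

/-- The Gram determinant `det (A† A)` as a real number. The matrix `A† A` is Hermitian positive
semidefinite, so its complex determinant is a nonnegative real number, equal to its real part. -/
noncomputable def gramDet {m n : ℕ} (A : Matrix (Fin m) (Fin n) ℂ) : ℝ :=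
  (Aᴴ * A).det.re

/-! Peel off the factors from the left. Let `P` be a partial product with `P† P` invertible. Writing
`P† P = B† B` and `U = P B⁻¹` gives `P = U B` with `U† U = 1`, so `det ((Q P)† (Q P)) = det ((Q U)†
(Q U)) * det (P† P)`. If `Q` is Gaussian and independent of `P`, then given `P` the matrix `Q U` is
again Gaussian, now with `N 0` columns, and its law does not depend on `U`. Taking logarithms and
integrating, first over `Q` and then over `P`, each factor adds the expectation for one smaller
Gaussian matrix.

The carriers are `IsRayleighMIMO.mul_isometry` (invariance, by characteristic functions),
`exists_isometry_mul_of_gramDet_pos` (factorization) and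
`IsRayleighMIMO.integral_log_gramDet_mul_of_indepFun` (one step, by Fubini).

Fubini needs integrable logarithms. From above, a Gram determinant is at most polynomial in the
squared Frobenius norm. From below, it dominates `|det T|²` for the top square block `T`; the
determinant of a square Gaussian matrix is affine in its corner entry, so induction on the size
reduces the bound to integrability of `log` near `0`. -/

section Measurability

variable {Ω α : Type*} [MeasurableSpace Ω] [MeasurableSpace α] {l m n : ℕ}

lemma measurable_matrix_iff {ι κ : Type*} {A : Ω → Matrix ι κ α} :
    Measurable A ↔ ∀ i j, Measurable fun ω => A ω i j := by
  constructor
  · intro h i j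
    exact (measurable_pi_apply j).comp ((measurable_pi_apply i).comp h)
  · intro h
    exact measurable_pi_lambda _ fun i => measurable_pi_lambda _ fun j => h i j

lemma Measurable.matrix_apply {ι κ : Type*} {A : Ω → Matrix ι κ α} (h : Measurable A) (i : ι)
    (j : κ) : Measurable fun ω => A ω i j :=
  measurable_matrix_iff.1 h i j

lemma Measurable.matrix_mul_complex {A : Ω → Matrix (Fin l) (Fin m) ℂ}
    {B : Ω → Matrix (Fin m) (Fin n) ℂ} (hA : Measurable A) (hB : Measurable B) :
    Measurable fun ω => A ω * B ω := by
  refine measurable_matrix_iff.2 fun i j => ?_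
  simp only [Matrix.mul_apply]
  exact Finset.measurable_fun_sum _ fun k _ => (hA.matrix_apply i k).mul (hB.matrix_apply k j)

lemma Measurable.matrix_conjTranspose_complex {A : Ω → Matrix (Fin m) (Fin n) ℂ}
    (hA : Measurable A) : Measurable fun ω => (A ω)ᴴ := by
  refine measurable_matrix_iff.2 fun i j => ?_
  simp only [Matrix.conjTranspose_apply]
  exact Complex.continuous_conj.measurable.comp (hA.matrix_apply j i)

lemma Measurable.matrix_det_complex {A : Ω → Matrix (Fin n) (Fin n) ℂ} (hA : Measurable A) :
    Measurable fun ω => (A ω).det := by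
  simp only [Matrix.det_apply']
  exact Finset.measurable_fun_sum _ fun σ _ =>
    (Finset.measurable_fun_prod _ fun i _ => hA.matrix_apply _ _).const_mul _

lemma measurable_gramDet : Measurable (gramDet (m := m) (n := n)) :=
  Complex.measurable_re.comp
    (measurable_id.matrix_conjTranspose_complex.matrix_mul_complex
      measurable_id).matrix_det_complex

end Measurability

/-! ### The complex Gaussian law: characteristic function, real part, second moment. -/

section StdComplexGaussian

instance isProbabilityMeasure_stdComplexGaussian : IsProbabilityMeasure stdComplexGaussian :=
  Measure.isProbabilityMeasure_map Complex.measurableEquivRealProd.symm.measurable.aemeasurable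

/-- Dependence on `t` through `‖t‖ ^ 2` alone is what yields unitary invariance. -/
lemma charFun_stdComplexGaussian (t : ℂ) :
    charFun stdComplexGaussian t = Complex.exp (-(‖t‖ ^ 2 / 4 : ℝ)) := by
  have h := charFun_gaussianReal (μ := 0) (v := 1 / 2)
  have h' : ∀ s : ℝ, ∫ x, Complex.exp (x * s * Complex.I) ∂(gaussianReal 0 (1 / 2)) =
      Complex.exp (-(s ^ 2 / 4 : ℝ)) := by
    intro s
    have := h s
    rw [charFun_apply] at this
    simp only [RCLike.inner_apply, conj_trivial] at this
    convert this using 2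
    · ext x; congr 1; push_cast; ring
    · push_cast; ring
  rw [charFun_apply, stdComplexGaussian, integral_map_equiv]
  have : ∀ p : ℝ × ℝ, Complex.exp
      (((inner ℝ (Complex.measurableEquivRealProd.symm p) t : ℝ) : ℂ) * Complex.I) =
      Complex.exp (p.1 * t.re * Complex.I) * Complex.exp (p.2 * t.im * Complex.I) := by
    intro p
    rw [← Complex.exp_add, Complex.inner]
    congr 1
    simp [Complex.measurableEquivRealProd]
    ring
  simp_rw [this]
  rw [integral_prod_mul (fun x : ℝ => Complex.exp (x * t.re * Complex.I))
    (fun x : ℝ => Complex.exp (x * t.im * Complex.I)), h', h', ← Complex.exp_add]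
  congr 1
  rw [← Complex.normSq_eq_norm_sq, Complex.normSq_apply]
  push_cast; ring

lemma map_re_stdComplexGaussian :
    stdComplexGaussian.map Complex.re = gaussianReal 0 (1 / 2) := by
  rw [stdComplexGaussian, Measure.map_map Complex.measurable_re (MeasurableEquiv.measurable _)]
  have : Complex.re ∘ Complex.measurableEquivRealProd.symm = Prod.fst := by
    ext p; simp [Complex.measurableEquivRealProd]
  rw [this]
  exact measurePreserving_fst.map_eq

lemma integrable_norm_sq_stdComplexGaussian :
    Integrable (fun z : ℂ => ‖z‖ ^ 2) stdComplexGaussian := by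
  rw [stdComplexGaussian, integrable_map_equiv]
  have h2 : Integrable (fun x : ℝ => x ^ 2) (gaussianReal 0 (1 / 2)) :=
    (memLp_id_gaussianReal 2).integrable_sq
  refine ((h2.comp_fst (gaussianReal 0 (1 / 2))).add
    (h2.comp_snd (gaussianReal 0 (1 / 2)))).congr (ae_of_all _ fun p => ?_)
  rw [Function.comp_apply, ← Complex.normSq_eq_norm_sq, Complex.normSq_apply, ← sq, ← sq]
  rfl

end StdComplexGaussian

/-! ### Gaussian matrices and their unitary invariance. -/

section RayleighMIMO

variable {Ω : Type*} [MeasurableSpace Ω] {μ : Measure Ω} {l m n : ℕ}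

lemma IsRayleighMIMO.aemeasurable_apply {Q : Ω → Matrix (Fin m) (Fin n) ℂ}
    (hQ : IsRayleighMIMO Q μ) (i : Fin m) (j : Fin n) : AEMeasurable (fun ω => Q ω i j) μ :=
  (hQ.1 i j).aemeasurable

lemma IsRayleighMIMO.aemeasurable {Q : Ω → Matrix (Fin m) (Fin n) ℂ}
    (hQ : IsRayleighMIMO Q μ) : AEMeasurable Q μ :=
  aemeasurable_pi_lambda _ fun i => aemeasurable_pi_lambda _ fun j => hQ.aemeasurable_apply i j

/-- Indexing the entries by pairs turns the definition into equality with a product measure, which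
characteristic functions can test. -/
lemma isRayleighMIMO_iff_map_eq [IsProbabilityMeasure μ] {Q : Ω → Matrix (Fin m) (Fin n) ℂ}
    (hm : ∀ i j, AEMeasurable (fun ω => Q ω i j) μ) :
    IsRayleighMIMO Q μ ↔ μ.map (fun ω (p : Fin m × Fin n) => Q ω p.1 p.2) =
      Measure.pi fun _ => stdComplexGaussian := by
  have hm' : ∀ p : Fin m × Fin n, AEMeasurable (fun ω => Q ω p.1 p.2) μ := fun p => hm _ _
  constructor
  · intro h
    rw [(iIndepFun_iff_map_fun_eq_pi_map hm').1 h.2]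
    congr 1; ext1 p
    exact (h.1 p.1 p.2).map_eq
  · intro h
    have h1 : ∀ p : Fin m × Fin n, μ.map (fun ω => Q ω p.1 p.2) = stdComplexGaussian := by
      intro p
      rw [← (measurePreserving_eval (fun _ : Fin m × Fin n => stdComplexGaussian) p).map_eq, ← h,
        AEMeasurable.map_map_of_aemeasurable (measurable_pi_apply p).aemeasurable
          (aemeasurable_pi_lambda _ hm')]
      rfl
    refine ⟨fun i j => ⟨hm i j, h1 (i, j)⟩, ?_⟩
    rw [iIndepFun_iff_map_fun_eq_pi_map hm', h]
    congr 1; ext1 p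
    exact (h1 p).symm

/-- The law of an `m × n` matrix with independent `CN(0, 1)` entries. -/
noncomputable def gaussianMatrix (m n : ℕ) : Measure (Matrix (Fin m) (Fin n) ℂ) :=
  (Measure.pi fun _ : Fin m × Fin n => stdComplexGaussian).map
    fun f => Matrix.of fun i j => f (i, j)

lemma measurable_of_pair :
    Measurable fun (f : Fin m × Fin n → ℂ) => (Matrix.of fun i j => f (i, j)) :=
  measurable_matrix_iff.2 fun i j => measurable_pi_apply (i, j)

instance isProbabilityMeasure_gaussianMatrix : IsProbabilityMeasure (gaussianMatrix m n) :=
  Measure.isProbabilityMeasure_map measurable_of_pair.aemeasurable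

lemma IsRayleighMIMO.map_eq [IsProbabilityMeasure μ] {Q : Ω → Matrix (Fin m) (Fin n) ℂ}
    (hQ : IsRayleighMIMO Q μ) : μ.map Q = gaussianMatrix m n := by
  rw [gaussianMatrix, ← (isRayleighMIMO_iff_map_eq hQ.aemeasurable_apply).1 hQ,
    AEMeasurable.map_map_of_aemeasurable measurable_of_pair.aemeasurable
      (aemeasurable_pi_lambda _ fun p => hQ.aemeasurable_apply p.1 p.2)]
  rfl

lemma isRayleighMIMO_id_gaussianMatrix :
    IsRayleighMIMO (fun A => A) (gaussianMatrix m n) := by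
  rw [isRayleighMIMO_iff_map_eq (Q := fun A => A)
    fun i j => (measurable_id.matrix_apply i j).aemeasurable, gaussianMatrix,
    Measure.map_map ?_ measurable_of_pair]
  · exact Measure.map_id
  · exact measurable_pi_lambda _ fun p => measurable_id.matrix_apply p.1 p.2

lemma IsRayleighMIMO.integral_comp [IsProbabilityMeasure μ]
    {Q : Ω → Matrix (Fin m) (Fin n) ℂ} (hQ : IsRayleighMIMO Q μ)
    {f : Matrix (Fin m) (Fin n) ℂ → ℝ} (hf : Measurable f) :
    ∫ ω, f (Q ω) ∂μ = ∫ A, f A ∂gaussianMatrix m n := by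
  rw [← hQ.map_eq, integral_map hQ.aemeasurable hf.aestronglyMeasurable]

/-- Both sums are traces `tr (B B†)`, and `T U† U T† = T T†`. -/
lemma sum_norm_sq_mul_conjTranspose {U : Matrix (Fin m) (Fin n) ℂ} (hU : Uᴴ * U = 1)
    (T : Matrix (Fin l) (Fin n) ℂ) :
    ∑ p : Fin l × Fin m, ‖(T * Uᴴ) p.1 p.2‖ ^ 2 = ∑ p : Fin l × Fin n, ‖T p.1 p.2‖ ^ 2 := by
  have key : ∀ {k : ℕ} (B : Matrix (Fin l) (Fin k) ℂ),
      ((∑ p : Fin l × Fin k, ‖B p.1 p.2‖ ^ 2 : ℝ) : ℂ) = (B * Bᴴ).trace := by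
    intro k B
    simp only [Matrix.trace, Matrix.diag, Matrix.mul_apply, Matrix.conjTranspose_apply,
      Fintype.sum_prod_type, Complex.ofReal_sum]
    refine Finset.sum_congr rfl fun i _ => Finset.sum_congr rfl fun j _ => ?_
    rw [← Complex.normSq_eq_norm_sq, Complex.normSq_eq_conj_mul_self, mul_comm]
    rfl
  have : ((∑ p : Fin l × Fin m, ‖(T * Uᴴ) p.1 p.2‖ ^ 2 : ℝ) : ℂ) =
      ((∑ p : Fin l × Fin n, ‖T p.1 p.2‖ ^ 2 : ℝ) : ℂ) := by
    rw [key, key, Matrix.conjTranspose_mul, Matrix.conjTranspose_conjTranspose,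
      Matrix.mul_assoc, ← Matrix.mul_assoc Uᴴ, hU, Matrix.one_mul]
  exact_mod_cast this

/-- Unitary invariance: a Gaussian matrix stays Gaussian after right multiplication by a matrix
with orthonormal columns. -/
lemma IsRayleighMIMO.mul_isometry [IsProbabilityMeasure μ] {Q : Ω → Matrix (Fin l) (Fin m) ℂ}
    (hQ : IsRayleighMIMO Q μ) {U : Matrix (Fin m) (Fin n) ℂ} (hU : Uᴴ * U = 1) :
    IsRayleighMIMO (fun ω => Q ω * U) μ := by
  have hm : ∀ i j, AEMeasurable (fun ω => (Q ω * U) i j) μ := by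
    intro i j
    simp only [Matrix.mul_apply]
    exact Finset.aemeasurable_fun_sum _ fun k _ => (hQ.aemeasurable_apply i k).mul_const _
  rw [isRayleighMIMO_iff_map_eq hm, ← charFun_eq_pi_iff]
  intro t
  have hmQ : AEMeasurable (fun ω (p : Fin l × Fin m) => Q ω p.1 p.2) μ :=
    aemeasurable_pi_lambda _ fun p => hQ.aemeasurable_apply p.1 p.2
  have hmU : AEMeasurable (fun ω (p : Fin l × Fin n) => (Q ω * U) p.1 p.2) μ :=
    aemeasurable_pi_lambda _ fun p => hm p.1 p.2
  have h1 := charFun_eq_pi_iff.2 ((isRayleighMIMO_iff_map_eq hQ.aemeasurable_apply).1 hQ)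
  let T : Matrix (Fin l) (Fin n) ℂ := Matrix.of fun i j => t (i, j)
  -- Right multiplication by `U` has adjoint `T ↦ T U†`, so the characteristic function of `Q U` at
  -- `T` is that of `Q` at `T U†`.
  have h2 := h1 (WithLp.toLp 2 fun p => (T * Uᴴ) p.1 p.2)
  have h3 : charFun (Measure.map (WithLp.toLp 2)
        (Measure.map (fun ω (p : Fin l × Fin n) => (Q ω * U) p.1 p.2) μ)) t =
      charFun (Measure.map (WithLp.toLp 2)
        (Measure.map (fun ω (p : Fin l × Fin m) => Q ω p.1 p.2) μ))
        (WithLp.toLp 2 fun p => (T * Uᴴ) p.1 p.2) := by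
    rw [charFun_apply, charFun_apply, ← MeasurableEquiv.coe_toLp, integral_map_equiv,
      ← MeasurableEquiv.coe_toLp, integral_map_equiv, integral_map hmU, integral_map hmQ]
    · refine integral_congr_ae (ae_of_all _ fun ω => ?_)
      simp only [MeasurableEquiv.coe_toLp, PiLp.inner_apply, Complex.inner]
      congr 3
      rw [← Complex.re_sum, ← Complex.re_sum]
      congr 1
      simp only [Fintype.sum_prod_type, Matrix.mul_apply, map_sum, map_mul, Finset.sum_mul,
        Finset.mul_sum, Matrix.conjTranspose_apply]
      refine Finset.sum_congr rfl fun i _ => ?_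
      rw [Finset.sum_comm]
      refine Finset.sum_congr rfl fun k _ => Finset.sum_congr rfl fun j _ => ?_
      simp only [T, Matrix.of_apply, RCLike.star_def]
      ring
    · apply Measurable.aestronglyMeasurable; fun_prop
    · apply Measurable.aestronglyMeasurable; fun_prop
  rw [h3, h2]
  simp only [charFun_stdComplexGaussian, ← Complex.exp_sum]
  congr 1
  simp only [Finset.sum_neg_distrib, ← Complex.ofReal_sum, ← Finset.sum_div]
  rw [sum_norm_sq_mul_conjTranspose hU T]
  rfl

end RayleighMIMO

/-! ### Deterministic identities and bounds for Gram determinants. -/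

section GramDet

open scoped ComplexOrder MatrixOrder

variable {l m n : ℕ}

lemma coe_gramDet (A : Matrix (Fin m) (Fin n) ℂ) : (gramDet A : ℂ) = (Aᴴ * A).det := by
  have h := (Matrix.posSemidef_conjTranspose_mul_self A).isHermitian.det_eq_prod_eigenvalues
  rw [gramDet, h]
  norm_cast

lemma gramDet_nonneg (A : Matrix (Fin m) (Fin n) ℂ) : 0 ≤ gramDet A := by
  have h := (Matrix.posSemidef_conjTranspose_mul_self A).det_nonneg
  rw [← coe_gramDet] at h
  exact_mod_cast h

lemma gramDet_mul_square (A : Matrix (Fin m) (Fin n) ℂ) (B : Matrix (Fin n) (Fin n) ℂ) :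
    gramDet (A * B) = gramDet A * ‖B.det‖ ^ 2 := by
  have : (gramDet (A * B) : ℂ) = ((gramDet A * ‖B.det‖ ^ 2 : ℝ) : ℂ) := by
    rw [coe_gramDet, Complex.ofReal_mul, coe_gramDet, Matrix.conjTranspose_mul,
      Matrix.mul_assoc, ← Matrix.mul_assoc Aᴴ, Matrix.det_mul, Matrix.det_mul,
      Matrix.det_conjTranspose, ← Complex.normSq_eq_norm_sq, Complex.normSq_eq_conj_mul_self]
    simp only [RCLike.star_def]
    ring
  exact_mod_cast this

lemma gramDet_of_conjTranspose_mul_self_eq_one {U : Matrix (Fin m) (Fin n) ℂ}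
    (hU : Uᴴ * U = 1) : gramDet U = 1 := by
  simp [gramDet, hU]

/-- Take `A† A = B† B` and `U = A B⁻¹`. That `U` is chosen before `G` matters: `G` is later random
while `U` stays fixed. -/
lemma exists_isometry_mul_of_gramDet_pos {A : Matrix (Fin m) (Fin n) ℂ} (hA : 0 < gramDet A) :
    ∃ U : Matrix (Fin m) (Fin n) ℂ, Uᴴ * U = 1 ∧
      ∀ {l : ℕ} (G : Matrix (Fin l) (Fin m) ℂ), gramDet (G * A) = gramDet (G * U) * gramDet A := by
  obtain ⟨B, hB⟩ := CStarAlgebra.nonneg_iff_eq_star_mul_self.mp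
    (Matrix.posSemidef_conjTranspose_mul_self A).nonneg
  rw [Matrix.star_eq_conjTranspose] at hB
  have hd : B.det ≠ 0 := by
    intro h
    have := coe_gramDet A
    rw [hB, Matrix.det_mul, h, mul_zero] at this
    exact hA.ne' (by exact_mod_cast this)
  have hu : IsUnit B.det := isUnit_iff_ne_zero.2 hd
  have hAU : A * B⁻¹ * B = A := by rw [Matrix.mul_assoc, Matrix.nonsing_inv_mul _ hu, Matrix.mul_one]
  have hU : (A * B⁻¹)ᴴ * (A * B⁻¹) = 1 := by
    rw [Matrix.conjTranspose_mul, Matrix.mul_assoc, ← Matrix.mul_assoc Aᴴ, hB, Matrix.mul_assoc,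
      Matrix.mul_nonsing_inv _ hu, Matrix.mul_one, ← Matrix.conjTranspose_mul,
      Matrix.mul_nonsing_inv _ hu, Matrix.conjTranspose_one]
  refine ⟨A * B⁻¹, hU, fun G => ?_⟩
  have h1 : gramDet A = ‖B.det‖ ^ 2 := by
    rw [← hAU, gramDet_mul_square, gramDet_of_conjTranspose_mul_self_eq_one hU, one_mul]
  rw [h1, ← gramDet_mul_square, Matrix.mul_assoc, hAU]

lemma one_le_det_one_add_of_posSemidef {D : Matrix (Fin n) (Fin n) ℂ} (hD : D.PosSemidef) :
    1 ≤ (1 + D).det.re := by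
  have h : (1 + D).det = ((∏ i, (1 + hD.isHermitian.eigenvalues i) : ℝ) : ℂ) := by
    -- At `-1` the characteristic polynomial of `D` is `det (1 + D)` up to the sign `(-1) ^ n`.
    have h1 := congrArg (Polynomial.eval (-1)) hD.isHermitian.charpoly_eq
    rw [Matrix.eval_charpoly, Polynomial.eval_prod] at h1
    have h2 : Matrix.scalar (Fin n) (-1 : ℂ) - D = -(1 + D) := by
      rw [map_neg, map_one]; abel
    rw [h2, Matrix.det_neg] at h1
    have h3 : ∏ i, Polynomial.eval (-1)
        (Polynomial.X - Polynomial.C ((hD.isHermitian.eigenvalues i : ℝ) : ℂ)) =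
        (-1) ^ n * ((∏ i, (1 + hD.isHermitian.eigenvalues i) : ℝ) : ℂ) := by
      have : ((-1 : ℂ)) ^ n = ∏ _i : Fin n, (-1 : ℂ) := by simp
      rw [this, Complex.ofReal_prod, ← Finset.prod_mul_distrib]
      refine Finset.prod_congr rfl fun i _ => ?_
      simp; ring
    rw [Fintype.card_fin] at h1
    exact mul_left_cancel₀ (pow_ne_zero n (by norm_num : (-1 : ℂ) ≠ 0)) (h1.trans h3)
  rw [h, Complex.ofReal_re]
  simpa using Finset.prod_le_prod (s := Finset.univ) (f := fun _ : Fin n => (1 : ℝ))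
    (fun _ _ => zero_le_one) fun i _ => le_add_of_nonneg_right (hD.eigenvalues_nonneg i)

/-- When the top block `T` is invertible, `A = C T` where `C` has top block `1` and bottom block
`E`, so `C† C = 1 + E† E` has determinant at least `1`. -/
lemma norm_det_sq_le_gramDet {k : ℕ} (A : Matrix (Fin (n + k)) (Fin n) ℂ) :
    ‖(A.submatrix (Fin.castAdd k) id).det‖ ^ 2 ≤ gramDet A := by
  set T := A.submatrix (Fin.castAdd k) id with hT
  by_cases hd : T.det = 0
  · simpa [hd] using gramDet_nonneg A
  have hu : IsUnit T.det := isUnit_iff_ne_zero.2 hd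
  have hA : A * T⁻¹ * T = A := by rw [Matrix.mul_assoc, Matrix.nonsing_inv_mul _ hu, Matrix.mul_one]
  set C := A * T⁻¹ with hC
  have htop : C.submatrix (Fin.castAdd k) id = 1 := by
    rw [← Matrix.mul_nonsing_inv _ hu]
    ext i j
    simp [hC, Matrix.mul_apply, T]
  have hG : Cᴴ * C = 1 + (C.submatrix (Fin.natAdd n) id)ᴴ * C.submatrix (Fin.natAdd n) id := by
    have : (1 : Matrix (Fin n) (Fin n) ℂ) =
        (C.submatrix (Fin.castAdd k) id)ᴴ * C.submatrix (Fin.castAdd k) id := by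
      rw [htop]; simp
    rw [this]
    ext i j
    simp [Matrix.mul_apply, Fin.sum_univ_add]
  have h1 : 1 ≤ gramDet C := by
    rw [gramDet, hG]
    exact one_le_det_one_add_of_posSemidef (Matrix.posSemidef_conjTranspose_mul_self _)
  rw [← hA, gramDet_mul_square]
  exact le_mul_of_one_le_left (sq_nonneg _) h1

/-- Leibniz expansion, with every entry of `A† A` bounded by `1 + s`; the added `1` later permits
`log (1 + s) ≤ s`. -/
lemma gramDet_le (A : Matrix (Fin m) (Fin n) ℂ) :
    gramDet A ≤ n.factorial * (1 + ∑ p : Fin m × Fin n, ‖A p.1 p.2‖ ^ 2) ^ n := by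
  set s := ∑ p : Fin m × Fin n, ‖A p.1 p.2‖ ^ 2 with hs
  have hent : ∀ i j, IsAbsoluteValue.toAbsoluteValue (norm : ℂ → ℝ) ((Aᴴ * A) i j) ≤ 1 + s := by
    intro i j
    have hcol : ∀ j, ∑ k, ‖A k j‖ ^ 2 ≤ s := by
      intro j
      rw [hs, Fintype.sum_prod_type]
      refine Finset.sum_le_sum fun k _ => ?_
      exact Finset.single_le_sum (f := fun j => ‖A k j‖ ^ 2) (fun _ _ => sq_nonneg _)
        (Finset.mem_univ j)
    calc ‖(Aᴴ * A) i j‖ ≤ ∑ k, ‖A k i‖ * ‖A k j‖ := by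
          rw [Matrix.mul_apply]
          refine (norm_sum_le _ _).trans (le_of_eq ?_)
          simp
      _ ≤ ∑ k, (‖A k i‖ ^ 2 + ‖A k j‖ ^ 2) / 2 :=
          Finset.sum_le_sum fun k _ => by nlinarith [sq_nonneg (‖A k i‖ - ‖A k j‖)]
      _ ≤ 1 + s := by
          rw [← Finset.sum_div, Finset.sum_add_distrib]
          linarith [hcol i, hcol j]
  have h := Matrix.det_le hent
  rw [Fintype.card_fin, nsmul_eq_mul] at h
  exact (Complex.re_le_norm _).trans h

lemma log_gramDet_le {A : Matrix (Fin m) (Fin n) ℂ} (hA : 0 < gramDet A) :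
    Real.log (gramDet A) ≤
      Real.log n.factorial + n * ∑ p : Fin m × Fin n, ‖A p.1 p.2‖ ^ 2 := by
  set s := ∑ p : Fin m × Fin n, ‖A p.1 p.2‖ ^ 2 with hs
  have hs0 : 0 ≤ s := Finset.sum_nonneg fun _ _ => sq_nonneg _
  calc Real.log (gramDet A) ≤ Real.log (n.factorial * (1 + s) ^ n) :=
        Real.log_le_log hA (gramDet_le A)
    _ = Real.log n.factorial + n * Real.log (1 + s) := by
        rw [Real.log_mul (by positivity) (by positivity), Real.log_pow]
    _ ≤ _ := by
        gcongr
        linarith [Real.log_le_sub_one_of_pos (show 0 < 1 + s by linarith)]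

end GramDet

/-! ### Negative logarithms under the Gaussian law. -/

section LogBounds

lemma gaussianReal_half_le_volume : gaussianReal 0 (1 / 2) ≤ volume := by
  rw [gaussianReal_of_var_ne_zero _ (by norm_num)]
  calc volume.withDensity (gaussianPDF 0 (1 / 2)) ≤ volume.withDensity 1 := by
        refine withDensity_mono (ae_of_all _ fun x => ?_)
        rw [gaussianPDF, Pi.one_apply, ENNReal.ofReal_le_one, gaussianPDFReal]
        refine mul_le_one₀ (inv_le_one_of_one_le₀ (Real.one_le_sqrt.2 ?_)) (Real.exp_nonneg _)
          (Real.exp_le_one_iff.2 ?_)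
        · push_cast; linarith [Real.pi_gt_three]
        · exact div_nonpos_of_nonpos_of_nonneg (by nlinarith [sq_nonneg (x - 0)]) (by positivity)
    _ = volume := withDensity_one

lemma lintegral_neg_log_lt_top : ∫⁻ x : ℝ, ENNReal.ofReal (-Real.log x) < ⊤ := by
  have h : IntegrableOn Real.log (Set.Icc (-1) 1) := by
    have := (intervalIntegral.intervalIntegrable_log' (a := -1) (b := 1))
    rwa [intervalIntegrable_iff_integrableOn_Icc_of_le (by norm_num)] at this
  have h2 : ∫⁻ x in Set.Icc (-1 : ℝ) 1, ENNReal.ofReal (-Real.log x) < ⊤ :=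
    h.neg.lintegral_lt_top
  rwa [setLIntegral_eq_of_support_subset] at h2
  -- `Real.log x` means `log |x|`, so `-log x` is positive only for `|x| < 1`.
  intro x hx
  rw [Function.mem_support, ne_eq, ENNReal.ofReal_eq_zero, not_le] at hx
  by_contra hc
  have : 1 ≤ |x| := by
    by_contra h'
    exact hc ⟨by linarith [(abs_lt.1 (not_le.1 h')).1], (abs_lt.1 (not_le.1 h')).2.le⟩
  have := Real.log_nonneg this
  rw [Real.log_abs] at this
  linarith

/-- The Gaussian density is at most `1` and Lebesgue measure is translation invariant, so the bound
is uniform in the shift `w`. -/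
lemma lintegral_neg_log_add_le (w : ℝ) :
    ∫⁻ z, ENNReal.ofReal (-Real.log (z.re + w)) ∂stdComplexGaussian ≤
      ∫⁻ x : ℝ, ENNReal.ofReal (-Real.log x) := by
  have hm : Measurable fun x : ℝ => ENNReal.ofReal (-Real.log (x + w)) := by fun_prop
  calc ∫⁻ z, ENNReal.ofReal (-Real.log (z.re + w)) ∂stdComplexGaussian
      = ∫⁻ x, ENNReal.ofReal (-Real.log (x + w)) ∂(gaussianReal 0 (1 / 2)) := by
        rw [← map_re_stdComplexGaussian, lintegral_map hm Complex.measurable_re]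
    _ ≤ ∫⁻ x : ℝ, ENNReal.ofReal (-Real.log (x + w)) :=
        lintegral_mono' gaussianReal_half_le_volume le_rfl
    _ = _ := lintegral_add_right_eq_self (fun x => ENNReal.ofReal (-Real.log x)) w

lemma ae_re_add_ne_zero (w : ℝ) : ∀ᵐ z ∂stdComplexGaussian, z.re + w ≠ 0 := by
  have h : ∀ᵐ x ∂(gaussianReal 0 (1 / 2)), x + w ≠ 0 := by
    refine (Measure.absolutelyContinuous_of_le gaussianReal_half_le_volume).ae_le ?_
    filter_upwards [Measure.ae_ne volume (-w)] with x hx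
    intro hc
    exact hx (by linarith)
  rw [← map_re_stdComplexGaussian] at h
  exact ae_of_ae_map Complex.measurable_re.aemeasurable h

lemma neg_log_norm_le_neg_log_re {z : ℂ} (hz : z.re ≠ 0) :
    -Real.log ‖z‖ ≤ -Real.log z.re := by
  rw [← Real.log_abs z.re]
  exact neg_le_neg (Real.log_le_log (abs_pos.2 hz) (Complex.abs_re_le_norm z))

lemma ofReal_neg_log_norm_mul_add_le {z c b : ℂ} (hc : c ≠ 0) (hz : z.re + (b / c).re ≠ 0) :
    ENNReal.ofReal (-Real.log ‖z * c + b‖) ≤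
      ENNReal.ofReal (-Real.log (z.re + (b / c).re)) + ENNReal.ofReal (-Real.log ‖c‖) := by
  have h1 : z * c + b = (z + b / c) * c := by field_simp
  have h2 : (z + b / c).re ≠ 0 := by simpa using hz
  have h3 : z + b / c ≠ 0 := fun h => h2 (by rw [h]; rfl)
  refine le_trans (ENNReal.ofReal_le_ofReal ?_) ENNReal.ofReal_add_le
  rw [h1, norm_mul, Real.log_mul (norm_ne_zero_iff.2 h3) (norm_ne_zero_iff.2 hc)]
  have := neg_log_norm_le_neg_log_re h2
  rw [Complex.add_re] at this
  linarith

end LogBounds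

/-! ### Almost sure nonsingularity and integrability of the logarithm. -/

section LogIntegrability

variable {Ω : Type*} [MeasurableSpace Ω] {μ : Measure Ω} {m n : ℕ}

lemma IsRayleighMIMO.submatrix {Q : Ω → Matrix (Fin m) (Fin n) ℂ} (hQ : IsRayleighMIMO Q μ)
    {m' n' : ℕ} {f : Fin m' → Fin m} {g : Fin n' → Fin n} (hf : Function.Injective f)
    (hg : Function.Injective g) : IsRayleighMIMO (fun ω => (Q ω).submatrix f g) μ :=
  ⟨fun i j => hQ.1 (f i) (g j),
    hQ.2.precomp (g := fun p : Fin m' × Fin n' => (f p.1, g p.2)) (hf.prodMap hg)⟩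

/-- The matrix `A` with its upper left entry replaced by zero. -/
def zeroCorner (A : Matrix (Fin (n + 1)) (Fin (n + 1)) ℂ) :
    Matrix (Fin (n + 1)) (Fin (n + 1)) ℂ :=
  Matrix.of fun i j => if (i, j) = (0, 0) then 0 else A i j

lemma det_eq_corner_mul_add (A : Matrix (Fin (n + 1)) (Fin (n + 1)) ℂ) :
    A.det = A 0 0 * (A.submatrix Fin.succ Fin.succ).det + (zeroCorner A).det := by
  have h : ∀ j : Fin (n + 1), (zeroCorner A).submatrix Fin.succ j.succAbove =
      A.submatrix Fin.succ j.succAbove := by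
    intro j
    ext i k
    simp [zeroCorner, Fin.succ_ne_zero]
  rw [Matrix.det_succ_row_zero, Matrix.det_succ_row_zero (zeroCorner A), Fin.sum_univ_succ,
    Fin.sum_univ_succ (n := n)]
  simp only [h]
  simp [zeroCorner, Fin.succ_ne_zero, Fin.succAbove_zero]

lemma submatrix_succ_zeroCorner (A : Matrix (Fin (n + 1)) (Fin (n + 1)) ℂ) :
    (zeroCorner A).submatrix Fin.succ Fin.succ = A.submatrix Fin.succ Fin.succ := by
  ext i j
  simp [zeroCorner, Fin.succ_ne_zero]

lemma measurable_zeroCorner : Measurable (zeroCorner (n := n)) := by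
  refine measurable_matrix_iff.2 fun i j => ?_
  exact Measurable.ite (MeasurableSet.const _) measurable_const (measurable_id.matrix_apply i j)

lemma IsRayleighMIMO.indepFun_corner {Q : Ω → Matrix (Fin (n + 1)) (Fin (n + 1)) ℂ}
    (hQ : IsRayleighMIMO Q μ) : IndepFun (fun ω => Q ω 0 0) (fun ω => zeroCorner (Q ω)) μ := by
  classical
  let p₀ : Fin (n + 1) × Fin (n + 1) := (0, 0)
  let T : Finset (Fin (n + 1) × Fin (n + 1)) := Finset.univ.erase p₀
  have h := hQ.2.indepFun_finset₀ {p₀} T (by simp [T])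
    fun p => hQ.aemeasurable_apply p.1 p.2
  let φ : (T → ℂ) → Matrix (Fin (n + 1)) (Fin (n + 1)) ℂ := fun f =>
    Matrix.of fun i j => if h : (i, j) ∈ T then f ⟨(i, j), h⟩ else 0
  have hφ : Measurable φ := by
    refine measurable_matrix_iff.2 fun i j => ?_
    by_cases h : (i, j) ∈ T
    · simpa [φ, h] using measurable_pi_apply (⟨(i, j), h⟩ : T)
    · simp [φ, h]
  have h2 := h.comp (measurable_pi_apply (⟨p₀, Finset.mem_singleton_self _⟩ :
    ({p₀} : Finset (Fin (n + 1) × Fin (n + 1))))) hφ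
  have he : (fun ω => zeroCorner (Q ω)) = φ ∘ fun ω (p : T) => Q ω p.1.1 p.1.2 := by
    ext ω i j
    by_cases hij : (i, j) = p₀ <;> simp [φ, T, zeroCorner, hij, p₀, -Prod.mk.injEq]
  rw [he]
  exact h2

variable [IsProbabilityMeasure μ]

/-- Write `det = z c + b`, with `z` the corner entry and `c` its complementary minor. Induction
handles `c`; the factor `z + b / c` is handled through its real part, `z` being independent of the
other entries. -/
lemma IsRayleighMIMO.ae_det_ne_zero_and_lintegral_neg_log {n : ℕ}
    {Q : Ω → Matrix (Fin n) (Fin n) ℂ} (hQ : IsRayleighMIMO Q μ) :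
    (∀ᵐ ω ∂μ, (Q ω).det ≠ 0) ∧ ∫⁻ ω, ENNReal.ofReal (-Real.log ‖(Q ω).det‖) ∂μ < ⊤ := by
  induction n with
  | zero => simp
  | succ n ih =>
    have hsub := hQ.submatrix (Fin.succ_injective n) (Fin.succ_injective n)
    obtain ⟨hc, hint⟩ := ih hsub
    have hz := hQ.aemeasurable_apply 0 0
    have hX : AEMeasurable (fun ω => zeroCorner (Q ω)) μ :=
      measurable_zeroCorner.comp_aemeasurable hQ.aemeasurable
    have hlaw : μ.map (fun ω => (Q ω 0 0, zeroCorner (Q ω))) =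
        stdComplexGaussian.prod (μ.map fun ω => zeroCorner (Q ω)) := by
      rw [(indepFun_iff_map_prod_eq_prod_map_map hz hX).1 hQ.indepFun_corner, (hQ.1 0 0).map_eq]
    have : IsProbabilityMeasure (μ.map fun ω => zeroCorner (Q ω)) :=
      Measure.isProbabilityMeasure_map hX
    -- The real shift `(b / c).re` depends only on the matrix with zeroed corner. Where `c = 0` it
    -- takes the value `0`, which only concerns a null set.
    let w : Matrix (Fin (n + 1)) (Fin (n + 1)) ℂ → ℝ := fun B =>
      (B.det / (B.submatrix Fin.succ Fin.succ).det).re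
    have hw : Measurable w := by
      refine Complex.measurable_re.comp (measurable_id.matrix_det_complex.div
        (Measurable.matrix_det_complex ?_))
      exact measurable_matrix_iff.2 fun i j => measurable_id.matrix_apply _ _
    have hmeas : Measurable fun x : ℂ × Matrix (Fin (n + 1)) (Fin (n + 1)) ℂ =>
        x.1.re + w x.2 := by
      exact (Complex.measurable_re.comp measurable_fst).add (hw.comp measurable_snd)
    have hre : ∀ᵐ ω ∂μ, (Q ω 0 0).re + w (zeroCorner (Q ω)) ≠ 0 := by
      have : ∀ᵐ x ∂(stdComplexGaussian.prod (μ.map fun ω => zeroCorner (Q ω))),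
          x.1.re + w x.2 ≠ 0 := by
        have hset : MeasurableSet {x : ℂ × Matrix (Fin (n + 1)) (Fin (n + 1)) ℂ |
            x.1.re + w x.2 ≠ 0} := (hmeas (measurableSet_singleton 0)).compl
        rw [Measure.ae_prod_iff_ae_ae hset,
          Measure.ae_ae_comm (p := fun z B => Complex.re z + w B ≠ 0) hset]
        exact ae_of_all _ fun B => ae_re_add_ne_zero (w B)
      rw [← hlaw] at this
      exact ae_of_ae_map (hz.prodMk hX) this
    have hdet : ∀ ω, (Q ω).det = Q ω 0 0 * ((Q ω).submatrix Fin.succ Fin.succ).det +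
        (zeroCorner (Q ω)).det := fun ω => det_eq_corner_mul_add (Q ω)
    have hwQ : ∀ ω, w (zeroCorner (Q ω)) =
        ((zeroCorner (Q ω)).det / ((Q ω).submatrix Fin.succ Fin.succ).det).re := fun ω => by
      simp only [w, submatrix_succ_zeroCorner]
    constructor
    · filter_upwards [hc, hre] with ω h1 h2 h3
      rw [hwQ] at h2
      refine h2 ?_
      rw [← Complex.add_re, ← Complex.zero_re]
      congr 1
      rw [hdet] at h3
      field_simp
      simpa using h3
    · have hle : ∫⁻ ω, ENNReal.ofReal (-Real.log ((Q ω 0 0).re + w (zeroCorner (Q ω)))) ∂μ ≤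
          ∫⁻ x : ℝ, ENNReal.ofReal (-Real.log x) := by
        have hm : Measurable fun x : ℂ × Matrix (Fin (n + 1)) (Fin (n + 1)) ℂ =>
            ENNReal.ofReal (-Real.log (x.1.re + w x.2)) :=
          (Real.measurable_log.comp hmeas).neg.ennreal_ofReal
        rw [← lintegral_map' (f := fun x : ℂ × Matrix (Fin (n + 1)) (Fin (n + 1)) ℂ =>
            ENNReal.ofReal (-Real.log (x.1.re + w x.2))) hm.aemeasurable (hz.prodMk hX), hlaw,
          lintegral_prod_symm' _ hm]
        refine (lintegral_mono fun B => lintegral_neg_log_add_le (w B)).trans ?_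
        simp
      calc ∫⁻ ω, ENNReal.ofReal (-Real.log ‖(Q ω).det‖) ∂μ
          ≤ ∫⁻ ω, (ENNReal.ofReal (-Real.log ((Q ω 0 0).re + w (zeroCorner (Q ω)))) +
            ENNReal.ofReal (-Real.log ‖((Q ω).submatrix Fin.succ Fin.succ).det‖)) ∂μ := by
            refine lintegral_mono_ae ?_
            filter_upwards [hc, hre] with ω h1 h2
            rw [hdet, hwQ]
            rw [hwQ] at h2
            exact ofReal_neg_log_norm_mul_add_le h1 h2
        _ = ∫⁻ ω, ENNReal.ofReal (-Real.log ((Q ω 0 0).re + w (zeroCorner (Q ω)))) ∂μ +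
            ∫⁻ ω, ENNReal.ofReal (-Real.log ‖((Q ω).submatrix Fin.succ Fin.succ).det‖) ∂μ := by
            refine lintegral_add_left' ?_ _
            exact ((Real.measurable_log.comp hmeas).neg.ennreal_ofReal).comp_aemeasurable
              (hz.prodMk hX)
        _ < ⊤ := ENNReal.add_lt_top.2 ⟨hle.trans_lt lintegral_neg_log_lt_top, hint⟩

lemma IsRayleighMIMO.ae_gramDet_pos_and_integrable_log {Q : Ω → Matrix (Fin m) (Fin n) ℂ}
    (hQ : IsRayleighMIMO Q μ) (hnm : n ≤ m) :
    (∀ᵐ ω ∂μ, 0 < gramDet (Q ω)) ∧ Integrable (fun ω => Real.log (gramDet (Q ω))) μ := by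
  obtain ⟨k, rfl⟩ := Nat.exists_eq_add_of_le hnm
  have hT := hQ.submatrix (Fin.castAdd_injective n k) (Function.injective_id (α := Fin n))
  obtain ⟨h0, hint⟩ := hT.ae_det_ne_zero_and_lintegral_neg_log
  have hpos : ∀ᵐ ω ∂μ, 0 < gramDet (Q ω) := by
    filter_upwards [h0] with ω h
    exact (pow_pos (norm_pos_iff.2 h) 2).trans_le (norm_det_sq_le_gramDet (Q ω))
  refine ⟨hpos, ?_⟩
  have hs : Integrable (fun ω => ∑ p : Fin (n + k) × Fin n, ‖Q ω p.1 p.2‖ ^ 2) μ := by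
    refine integrable_finsetSum _ fun p _ => ?_
    have := integrable_norm_sq_stdComplexGaussian
    rw [← (hQ.1 p.1 p.2).map_eq] at this
    exact this.comp_aemeasurable (hQ.aemeasurable_apply p.1 p.2)
  have hmT : AEMeasurable (fun ω => Real.log ‖((Q ω).submatrix (Fin.castAdd k) id).det‖) μ :=
    Real.measurable_log.comp_aemeasurable
      ((measurable_id.matrix_det_complex.norm).comp_aemeasurable hT.aemeasurable)
  have hneg : Integrable
      (fun ω => max (-Real.log ‖((Q ω).submatrix (Fin.castAdd k) id).det‖) 0) μ := by
    refine ⟨(hmT.neg.max aemeasurable_const).aestronglyMeasurable, ?_⟩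
    have h : ∀ ω, 0 ≤ max (-Real.log ‖((Q ω).submatrix (Fin.castAdd k) id).det‖) 0 :=
      fun ω => le_max_right _ _
    rw [hasFiniteIntegral_iff_ofReal (ae_of_all _ h)]
    simpa [ENNReal.ofReal_max] using hint
  -- The `2` comes from the square in `norm_det_sq_le_gramDet`; the other terms are the upper bound
  -- `log_gramDet_le`.
  refine Integrable.mono' ((hneg.const_mul 2).add
      ((integrable_const (Real.log n.factorial)).add (hs.const_mul (n : ℝ))))
    ((measurable_gramDet.log).comp_aemeasurable hQ.aemeasurable).aestronglyMeasurable ?_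
  filter_upwards [h0, hpos] with ω h1 h2
  have hup := log_gramDet_le h2
  have hlow := Real.log_le_log (pow_pos (norm_pos_iff.2 h1) 2) (norm_det_sq_le_gramDet (Q ω))
  rw [Real.log_pow] at hlow
  have ha := le_max_left (-Real.log ‖((Q ω).submatrix (Fin.castAdd k) id).det‖) 0
  have hb := le_max_right (-Real.log ‖((Q ω).submatrix (Fin.castAdd k) id).det‖) 0
  have hn : 0 ≤ Real.log n.factorial :=
    Real.log_nonneg (by exact_mod_cast n.factorial_pos)
  have hsn : 0 ≤ (n : ℝ) * ∑ p : Fin (n + k) × Fin n, ‖Q ω p.1 p.2‖ ^ 2 := by positivity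
  rw [Real.norm_eq_abs, abs_le]
  simp only [Pi.add_apply]
  push_cast at hlow
  constructor <;> linarith

end LogIntegrability

/-! ### Multiplying by one independent factor, then iterating. -/

section ChannelProduct

variable {Ω : Type*} [MeasurableSpace Ω] {μ : Measure Ω} {l m n : ℕ}

/-- The one-step identity with `A` frozen. The bound on the integral of the norm supplies the
domination needed for Fubini. -/
lemma integral_log_gramDet_mul {A : Matrix (Fin m) (Fin n) ℂ} (hA : 0 < gramDet A) (hl : n ≤ l) :
    (∀ᵐ G ∂gaussianMatrix l m, 0 < gramDet (G * A)) ∧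
    Integrable (fun G => Real.log (gramDet (G * A))) (gaussianMatrix l m) ∧
    ∫ G, Real.log (gramDet (G * A)) ∂gaussianMatrix l m =
      ∫ G, Real.log (gramDet G) ∂gaussianMatrix l n + Real.log (gramDet A) ∧
    ∫ G, ‖Real.log (gramDet (G * A))‖ ∂gaussianMatrix l m ≤
      ∫ G, ‖Real.log (gramDet G)‖ ∂gaussianMatrix l n + ‖Real.log (gramDet A)‖ := by
  obtain ⟨U, hU, hGA⟩ := exists_isometry_mul_of_gramDet_pos hA
  have hR := (isRayleighMIMO_id_gaussianMatrix (m := l) (n := m)).mul_isometry hU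
  obtain ⟨hpos, hint⟩ := hR.ae_gramDet_pos_and_integrable_log hl
  have hlog : ∀ᵐ G ∂gaussianMatrix l m, Real.log (gramDet (G * U)) + Real.log (gramDet A) =
      Real.log (gramDet (G * A)) := by
    filter_upwards [hpos] with G hG
    rw [hGA, Real.log_mul hG.ne' hA.ne']
  have hint' : Integrable (fun G => Real.log (gramDet (G * A))) (gaussianMatrix l m) :=
    (hint.add (integrable_const _)).congr hlog
  refine ⟨?_, hint', ?_, ?_⟩
  · filter_upwards [hpos] with G hG
    rw [hGA]
    exact mul_pos hG hA
  · rw [← integral_congr_ae hlog, integral_add hint (integrable_const _),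
      hR.integral_comp (f := fun G => Real.log (gramDet G)) measurable_gramDet.log]
    simp
  · calc ∫ G, ‖Real.log (gramDet (G * A))‖ ∂gaussianMatrix l m
        ≤ ∫ G, (‖Real.log (gramDet (G * U))‖ + ‖Real.log (gramDet A)‖) ∂gaussianMatrix l m := by
          refine integral_mono_ae hint'.norm (hint.norm.add (integrable_const _)) ?_
          filter_upwards [hlog] with G hG
          rw [← hG]
          exact norm_add_le _ _
      _ = _ := by
          rw [integral_add hint.norm (integrable_const _),
            hR.integral_comp (f := fun G => ‖Real.log (gramDet G)‖) measurable_gramDet.log.norm]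
          simp

/-- Left multiplication by an independent Gaussian matrix. -/
lemma IsRayleighMIMO.integral_log_gramDet_mul_of_indepFun [IsProbabilityMeasure μ]
    {Q : Ω → Matrix (Fin l) (Fin m) ℂ} (hQ : IsRayleighMIMO Q μ)
    {A : Ω → Matrix (Fin m) (Fin n) ℂ} (hAm : AEMeasurable A μ) (hind : IndepFun Q A μ)
    (hl : n ≤ l) (hpos : ∀ᵐ ω ∂μ, 0 < gramDet (A ω))
    (hint : Integrable (fun ω => Real.log (gramDet (A ω))) μ) :
    (∀ᵐ ω ∂μ, 0 < gramDet (Q ω * A ω)) ∧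
    Integrable (fun ω => Real.log (gramDet (Q ω * A ω))) μ ∧
    ∫ ω, Real.log (gramDet (Q ω * A ω)) ∂μ =
      ∫ G, Real.log (gramDet G) ∂gaussianMatrix l n + ∫ ω, Real.log (gramDet (A ω)) ∂μ := by
  have hlaw : μ.map (fun ω => (Q ω, A ω)) = (gaussianMatrix l m).prod (μ.map A) := by
    rw [(indepFun_iff_map_prod_eq_prod_map_map hQ.aemeasurable hAm).1 hind, hQ.map_eq]
  have : IsProbabilityMeasure (μ.map A) := Measure.isProbabilityMeasure_map hAm
  have hmg : Measurable fun x : Matrix (Fin l) (Fin m) ℂ × Matrix (Fin m) (Fin n) ℂ =>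
      gramDet (x.1 * x.2) :=
    measurable_gramDet.comp (measurable_fst.matrix_mul_complex measurable_snd)
  have hpos' : ∀ᵐ B ∂μ.map A, 0 < gramDet B :=
    (ae_map_iff hAm (measurableSet_lt measurable_const measurable_gramDet)).2 hpos
  have hint' : Integrable (fun B => Real.log (gramDet B)) (μ.map A) :=
    (integrable_map_measure measurable_gramDet.log.aestronglyMeasurable hAm).2 hint
  have hprod : Integrable (fun x : Matrix (Fin l) (Fin m) ℂ × Matrix (Fin m) (Fin n) ℂ =>
      Real.log (gramDet (x.1 * x.2))) ((gaussianMatrix l m).prod (μ.map A)) := by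
    refine (integrable_prod_iff' hmg.log.aestronglyMeasurable).2 ⟨?_, ?_⟩
    · filter_upwards [hpos'] with B hB
      exact (integral_log_gramDet_mul hB hl).2.1
    · refine Integrable.mono' ((integrable_const
        (∫ G, ‖Real.log (gramDet G)‖ ∂gaussianMatrix l n)).add hint'.norm)
        (hmg.log.norm.stronglyMeasurable.integral_prod_left'.aestronglyMeasurable) ?_
      filter_upwards [hpos'] with B hB
      rw [Real.norm_of_nonneg (integral_nonneg fun _ => norm_nonneg _)]
      exact (integral_log_gramDet_mul hB hl).2.2.2
  have hmQA := hQ.aemeasurable.prodMk hAm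
  refine ⟨?_, ?_, ?_⟩
  · have : ∀ᵐ x ∂(gaussianMatrix l m).prod (μ.map A), 0 < gramDet (x.1 * x.2) := by
      have hset := measurableSet_lt (measurable_const (a := (0 : ℝ))) hmg
      rw [Measure.ae_prod_iff_ae_ae hset,
        Measure.ae_ae_comm (p := fun G B => 0 < gramDet (G * B)) hset]
      filter_upwards [hpos'] with B hB
      exact (integral_log_gramDet_mul hB hl).1
    rw [← hlaw] at this
    exact ae_of_ae_map hmQA this
  · rw [← hlaw] at hprod
    exact hprod.comp_aemeasurable hmQA
  · calc ∫ ω, Real.log (gramDet (Q ω * A ω)) ∂μ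
        = ∫ x, Real.log (gramDet (x.1 * x.2)) ∂(gaussianMatrix l m).prod (μ.map A) := by
          rw [← hlaw, integral_map hmQA hmg.log.aestronglyMeasurable]
      _ = ∫ B, ∫ G, Real.log (gramDet (G * B)) ∂gaussianMatrix l m ∂μ.map A :=
          integral_prod_symm _ hprod
      _ = ∫ B, (∫ G, Real.log (gramDet G) ∂gaussianMatrix l n + Real.log (gramDet B))
            ∂μ.map A := by
          refine integral_congr_ae ?_
          filter_upwards [hpos'] with B hB
          exact (integral_log_gramDet_mul hB hl).2.2.1
      _ = _ := by
          rw [integral_add (integrable_const _) hint',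
            integral_map hAm measurable_gramDet.log.aestronglyMeasurable]
          simp

variable {K : ℕ} {N : Fin (K + 1) → ℕ}

/-- The partial product of the first `i` factors of `channelProduct`. -/
def channelPartialProduct (N : Fin (K + 1) → ℕ)
    (q : ∀ k : Fin K, Matrix (Fin (N k.succ)) (Fin (N k.castSucc)) ℂ) (i : Fin (K + 1)) :
    Matrix (Fin (N i)) (Fin (N 0)) ℂ :=
  Fin.induction (motive := fun i => Matrix (Fin (N i)) (Fin (N 0)) ℂ) 1 (fun k P => q k * P) i

lemma channelPartialProduct_succ
    (q : ∀ k : Fin K, Matrix (Fin (N k.succ)) (Fin (N k.castSucc)) ℂ) (k : Fin K) :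
    channelPartialProduct N q k.succ = q k * channelPartialProduct N q k.castSucc :=
  rfl

/-- A partial product sees only the earlier factors, so the others may be replaced by anything. -/
lemma channelPartialProduct_congr
    {q q' : ∀ k : Fin K, Matrix (Fin (N k.succ)) (Fin (N k.castSucc)) ℂ} (i : Fin (K + 1))
    (h : ∀ k : Fin K, k.castSucc < i → q k = q' k) :
    channelPartialProduct N q i = channelPartialProduct N q' i := by
  induction i using Fin.induction with
  | zero => rfl
  | succ k ih =>
    rw [channelPartialProduct_succ, channelPartialProduct_succ, h k Fin.castSucc_lt_succ,
      ih fun j hj => h j (hj.trans Fin.castSucc_lt_succ)]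

lemma measurable_channelPartialProduct (i : Fin (K + 1)) :
    Measurable fun q => channelPartialProduct N q i := by
  induction i using Fin.induction with
  | zero => exact measurable_const
  | succ k ih => exact (measurable_pi_apply k).matrix_mul_complex ih

lemma indepFun_channelPartialProduct
    {Q : ∀ k : Fin K, Ω → Matrix (Fin (N k.succ)) (Fin (N k.castSucc)) ℂ}
    (hQ : ∀ k, AEMeasurable (Q k) μ) (hind : iIndepFun Q μ) (k : Fin K) :
    IndepFun (Q k) (fun ω => channelPartialProduct N (fun j => Q j ω) k.castSucc) μ := by
  classical
  let T : Finset (Fin K) := Finset.univ.filter (· < k)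
  have h := hind.indepFun_finset₀ {k} T (by simp [T]) hQ
  -- Padding with zeros makes the partial product a measurable function of the factors before `k`
  -- alone.
  let ext : (∀ j : T, Matrix (Fin (N (j : Fin K).succ)) (Fin (N (j : Fin K).castSucc)) ℂ) →
      ∀ j : Fin K, Matrix (Fin (N j.succ)) (Fin (N j.castSucc)) ℂ := fun q j =>
    if h : j ∈ T then q ⟨j, h⟩ else 0
  have hext : Measurable ext := by
    refine measurable_pi_lambda _ fun j => ?_
    by_cases h : j ∈ T
    · simpa [ext, h] using measurable_pi_apply (⟨j, h⟩ : T)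
    · simp [ext, h]
  have h2 := h.comp (measurable_pi_apply (⟨k, Finset.mem_singleton_self k⟩ :
    ({k} : Finset (Fin K)))) ((measurable_channelPartialProduct k.castSucc).comp hext)
  have he : (fun ω => channelPartialProduct N (fun j => Q j ω) k.castSucc) =
      (fun q => channelPartialProduct N q k.castSucc) ∘ ext ∘ fun ω (j : T) => Q j ω := by
    ext1 ω
    refine channelPartialProduct_congr _ fun j hj => ?_
    have : j ∈ T := by simpa [T] using hj
    simp [ext, this]
  rw [he]
  exact h2

lemma channelPartialProduct_log_gramDet [IsProbabilityMeasure μ] (hN : ∀ k, N 0 ≤ N k)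
    {Q : ∀ k : Fin K, Ω → Matrix (Fin (N k.succ)) (Fin (N k.castSucc)) ℂ}
    (hQ : ∀ k, IsRayleighMIMO (Q k) μ) (hind : iIndepFun Q μ) (i : Fin (K + 1)) :
    (∀ᵐ ω ∂μ, 0 < gramDet (channelPartialProduct N (fun k => Q k ω) i)) ∧
    Integrable (fun ω => Real.log (gramDet (channelPartialProduct N (fun k => Q k ω) i))) μ ∧
    ∫ ω, Real.log (gramDet (channelPartialProduct N (fun k => Q k ω) i)) ∂μ =
      ∑ k : Fin K with k.castSucc < i,
        ∫ G, Real.log (gramDet G) ∂gaussianMatrix (N k.succ) (N 0) := by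
  induction i using Fin.induction with
  | zero =>
    have h1 : ∀ ω, gramDet (channelPartialProduct N (fun k => Q k ω) 0) = 1 := fun ω =>
      gramDet_of_conjTranspose_mul_self_eq_one (by simp [channelPartialProduct])
    simp [h1]
  | succ k ih =>
    have hm : AEMeasurable (fun ω => channelPartialProduct N (fun j => Q j ω) k.castSucc) μ :=
      (measurable_channelPartialProduct k.castSucc).comp_aemeasurable
        (aemeasurable_pi_lambda _ fun j => (hQ j).aemeasurable)
    obtain ⟨h1, h2, h3⟩ := (hQ k).integral_log_gramDet_mul_of_indepFun hm
      (indepFun_channelPartialProduct (fun j => (hQ j).aemeasurable) hind k) (hN _) ih.1 ih.2.1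
    refine ⟨h1, h2, ?_⟩
    have hfil : (Finset.univ.filter fun j : Fin K => j.castSucc < k.succ) =
        insert k (Finset.univ.filter fun j : Fin K => j.castSucc < k.castSucc) := by
      ext j
      simp [Fin.castSucc_lt_succ_iff, le_iff_eq_or_lt]
    rw [hfil, Finset.sum_insert (by simp), ← ih.2.2]
    exact h3

end ChannelProduct

theorem lemma1 {Ω Ω' : Type*} [MeasurableSpace Ω] [MeasurableSpace Ω']
    (μ : Measure Ω) [IsProbabilityMeasure μ] (ν : Measure Ω') [IsProbabilityMeasure ν]
    (K : ℕ) (N : Fin (K + 1) → ℕ) (hN : ∀ k, N 0 ≤ N k)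
    (Q : ∀ k : Fin K, Ω → Matrix (Fin (N k.succ)) (Fin (N k.castSucc)) ℂ)
    (hQ : ∀ k, IsRayleighMIMO (Q k) μ) (hQindep : iIndepFun Q μ)
    (Qhat : ∀ k : Fin K, Ω' → Matrix (Fin (N k.succ)) (Fin (N 0)) ℂ)
    (hQhat : ∀ k, IsRayleighMIMO (Qhat k) ν) (hQhatindep : iIndepFun Qhat ν) :
    (∀ᵐ ω ∂μ, 0 < gramDet (channelProduct N fun k => Q k ω)) ∧
    (∀ k, ∀ᵐ ω ∂ν, 0 < gramDet (Qhat k ω)) ∧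
    Integrable (fun ω => Real.log (gramDet (channelProduct N fun k => Q k ω))) μ ∧
    (∀ k, Integrable (fun ω => Real.log (gramDet (Qhat k ω))) ν) ∧
    ∫ ω, Real.log (gramDet (channelProduct N fun k => Q k ω)) ∂μ =
      ∑ k : Fin K, ∫ ω, Real.log (gramDet (Qhat k ω)) ∂ν := by
  -- `channelProduct` is definitionally the partial product at `Fin.last K`.
  obtain ⟨h1, h2, h3⟩ := channelPartialProduct_log_gramDet hN hQ hQindep (Fin.last K)
  have hhat := fun k => (hQhat k).ae_gramDet_pos_and_integrable_log (hN k.succ)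
  refine ⟨h1, fun k => (hhat k).1, h2, fun k => (hhat k).2, h3.trans ?_⟩
  rw [Finset.filter_true_of_mem fun k _ => Fin.castSucc_lt_last k]
  exact Finset.sum_congr rfl fun k _ =>
    ((hQhat k).integral_comp (f := fun G => Real.log (gramDet G)) measurable_gramDet.log).symm
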